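/- **Theorem.** Let $T^2=(\mathbb R/\mathbb Z)^2$ and let $\mathcal V^2(T^2)$ be the space of $C^2$ vector fields on $T^2$ with the $C^2$ topology. Two fields $v,w\in\mathcal V^2(T^2)$ are *orbitally topologically equivalent*, $v\sim w$, if there is a homeomorphism $H\colon T^2\to T^2$, homotopic to the identity, that takes the orbits of $v$ to the orbits of $w$ and preserves time orientation. For $\varphi\in\mathbb R$ let $E_\varphi$ be the equivalence relation on $\mathbb R/\mathbb Z$ given by $x\sim_{E_\varphi}y$ iff $x=y+n\varphi \bmod 1$ for some $n\in\mathbb Z$, and let $X_\varphi=(\mathbb R/\mathbb Z)\setminus\{n\varphi \bmod 1 : n\in\mathbb Z\}$. For each irrational $\varphi$ there is a family of vector fields $v_{\rho,\varphi}\in\mathcal V^2(T^2)$, $\rho\in\mathbb R/\mathbb Z$, which is smooth (that is, $(\rho,x,y)\mapsto v_{\rho,\varphi}(x,y)$ is $C^\infty$), such that for all $\rho_1,\rho_2\in X_\varphi$ $$v_{\rho_1,\varphi}\sim v_{\rho_2,\varphi}\iff \rho_1-\rho_2= n\varphi \bmod 1\ \text{ for some } n\in\mathbb Z ,$$ and the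 map $X_\varphi\to\mathcal V^2(T^2)$, $\rho\mapsto v_{\rho,\varphi}$, is a Borel reduction of the restriction of $E_\varphi$ to $X_\varphi$ to orbital topological equivalence: it is a Borel map between Polish spaces, and $\rho_1\sim_{E_\varphi}\rho_2$ if and only if $v_{\rho_1,\varphi}\sim v_{\rho_2,\varphi}$. In particular $E_\varphi$ on $X_\varphi$ is Borel reducible to orbital topological equivalence on $\mathcal V^2(T^2)$. -/

import Mathlib

open Set Filter Topology
open scoped ContDiff

namespace TorusField

/-- The two-torus `T² = (ℝ/ℤ)²`. -/
abbrev Torus : Type := UnitAddCircle × UnitAddCircle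

/-- The universal covering `ℝ² → T²`. -/
def proj (p : ℝ × ℝ) : Torus := ((p.1 : UnitAddCircle), (p.2 : UnitAddCircle))

theorem continuous_proj : Continuous proj :=
  ((AddCircle.continuous_mk' (1 : ℝ)).comp continuous_fst).prodMk
    ((AddCircle.continuous_mk' (1 : ℝ)).comp continuous_snd)

theorem proj_surjective : Function.Surjective proj := by
  rintro ⟨a, b⟩
  obtain ⟨x, rfl⟩ := QuotientAddGroup.mk_surjective a
  obtain ⟨y, rfl⟩ := QuotientAddGroup.mk_surjective b
  exact ⟨(x, y), rfl⟩

/-- The space `𝒱²(T²)` of `C²` vector fields on the two-torus. The tangent bundle of `T²` is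
trivialised by the covering `ℝ² → T²`, so that a vector field is a map `T² → ℝ²`; it is `C²` when
its lift to `ℝ²` is. -/
@[ext]
structure VectorField where
  /-- the value of the field, in the coordinates of the covering plane -/
  toFun : Torus → ℝ × ℝ
  contDiff_lift : ContDiff ℝ 2 (fun p : ℝ × ℝ => toFun (proj p))

namespace VectorField

/-- The lift of a vector field to the covering plane. -/
def lift (v : VectorField) (p : ℝ × ℝ) : ℝ × ℝ := v.toFun (proj p)

theorem contDiff_fderiv_lift (v : VectorField) : ContDiff ℝ 1 (fderiv ℝ v.lift) :=
  ContDiff.fderiv_right (m := 1) (n := 2) v.contDiff_lift (by norm_num)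

theorem contDiff_fderiv_fderiv_lift (v : VectorField) :
    ContDiff ℝ 0 (fderiv ℝ (fderiv ℝ v.lift)) :=
  ContDiff.fderiv_right (m := 0) (n := 1) v.contDiff_fderiv_lift (by norm_num)

/-- The product of spaces of continuous maps in which the 2-jet of a vector field lives; each factor has
the topology of uniform convergence on compact sets. -/
abbrev JetSpace : Type :=
  C(ℝ × ℝ, ℝ × ℝ) × C(ℝ × ℝ, (ℝ × ℝ) →L[ℝ] (ℝ × ℝ)) ×
    C(ℝ × ℝ, (ℝ × ℝ) →L[ℝ] ((ℝ × ℝ) →L[ℝ] (ℝ × ℝ)))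

/-- The 2-jet of a vector field: the lift and its first and second derivatives. -/
noncomputable def jet (v : VectorField) : JetSpace :=
  (⟨v.lift, v.contDiff_lift.continuous⟩,
    ⟨fderiv ℝ v.lift, v.contDiff_fderiv_lift.continuous⟩,
    ⟨fderiv ℝ (fderiv ℝ v.lift), v.contDiff_fderiv_fderiv_lift.continuous⟩)

/-- The `C²` topology: uniform convergence of the field and of its first two derivatives.
(The lifts are periodic, so that uniform convergence on compact sets of the plane is uniform
convergence.) -/
noncomputable instance : TopologicalSpace VectorField :=
  TopologicalSpace.induced jet inferInstance

theorem jet_injective : Function.Injective jet := by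
  intro v w h
  ext1
  funext q
  obtain ⟨p, rfl⟩ := proj_surjective q
  exact DFunLike.congr_fun (congrArg Prod.fst h) p

theorem range_jet : range jet =
    {J : JetSpace | (∀ p q, proj p = proj q → J.1 p = J.1 q) ∧
      (∀ p, HasFDerivAt J.1 (J.2.1 p) p) ∧ ∀ p, HasFDerivAt J.2.1 (J.2.2 p) p} := by
  ext J
  constructor
  · rintro ⟨v, rfl⟩
    refine ⟨fun p q h => congrArg v.toFun h, fun p => ?_, fun p => ?_⟩
    · exact (v.contDiff_lift.differentiable (by norm_num) p).hasFDerivAt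
    · exact (v.contDiff_fderiv_lift.differentiable (by norm_num) p).hasFDerivAt
  · obtain ⟨a, b, c⟩ := J
    rintro ⟨h0, h1, h2⟩
    have e1 : fderiv ℝ a = ⇑b := funext fun p => (h1 p).fderiv
    have e2 : fderiv ℝ b = ⇑c := funext fun p => (h2 p).fderiv
    have hb : ContDiff ℝ 1 b :=
      contDiff_one_iff_fderiv.2 ⟨fun p => (h2 p).differentiableAt, e2 ▸ c.continuous⟩
    have ha : ContDiff ℝ 2 a := by
      have : ContDiff ℝ (1 + 1) a :=
        contDiff_succ_iff_fderiv.2 ⟨fun p => (h1 p).differentiableAt, by simp, e1 ▸ hb⟩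
      simpa [one_add_one_eq_two] using this
    have key : ∀ p, a (Function.surjInv proj_surjective (proj p)) = a p := fun p =>
      h0 _ _ (Function.surjInv_eq proj_surjective (proj p))
    let v : VectorField :=
      ⟨fun q => a (Function.surjInv proj_surjective q), by simpa only [key] using ha⟩
    have hl : v.lift = a := funext key
    refine ⟨v, ?_⟩
    refine Prod.ext (ContinuousMap.ext fun p => ?_)
      (Prod.ext (ContinuousMap.ext fun p => ?_) (ContinuousMap.ext fun p => ?_))
    · exact congrFun hl p
    · change fderiv ℝ v.lift p = b p
      rw [hl, e1]
    · change fderiv ℝ (fderiv ℝ v.lift) p = c p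
      rw [hl, e1, e2]

theorem isClosed_hasFDerivAt {F : Type*} [NormedAddCommGroup F] [NormedSpace ℝ F] :
    IsClosed {J : C(ℝ × ℝ, F) × C(ℝ × ℝ, (ℝ × ℝ) →L[ℝ] F) |
      ∀ p, HasFDerivAt J.1 (J.2 p) p} := by
  refine isClosed_iff_forall_filter.2 fun J l hl hS hJ p => ?_
  have hJ1 : Tendsto (fun K : C(ℝ × ℝ, F) × C(ℝ × ℝ, (ℝ × ℝ) →L[ℝ] F) => K.1) l (𝓝 J.1) :=
    (continuous_fst.tendsto J).mono_left hJ
  have hJ2 : Tendsto (fun K : C(ℝ × ℝ, F) × C(ℝ × ℝ, (ℝ × ℝ) →L[ℝ] F) => K.2) l (𝓝 J.2) :=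
    (continuous_snd.tendsto J).mono_left hJ
  have hS' : ∀ᶠ K in l, ∀ p, HasFDerivAt K.1 (K.2 p) p := le_principal_iff.1 hS
  refine hasFDerivAt_of_tendstoUniformlyOnFilter (l := l)
    (f := fun K : C(ℝ × ℝ, F) × C(ℝ × ℝ, (ℝ × ℝ) →L[ℝ] F) => K.1)
    (f' := fun K => K.2) ?_ ?_ ?_
  · have := (ContinuousMap.tendsto_iff_tendstoLocallyUniformly.1 hJ2)
    exact (tendstoLocallyUniformly_iff_forall_tendsto.1 this p) |>
      fun h => tendstoUniformlyOnFilter_iff_tendsto.2 h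
  · exact (hS'.prod_inl (𝓝 p)).mono fun K hK => hK K.2
  · exact Eventually.of_forall fun q => ((continuous_eval_const q).tendsto _).comp hJ1

theorem isClosed_range_jet : IsClosed (range jet) := by
  rw [range_jet]
  refine IsClosed.inter ?_ (IsClosed.inter ?_ ?_)
  · change IsClosed {J : JetSpace | ∀ p q, proj p = proj q → J.1 p = J.1 q}
    simp only [ofPred_forall]
    refine isClosed_iInter fun p => isClosed_iInter fun q => isClosed_iInter fun _ => ?_
    exact isClosed_eq ((continuous_eval_const p).comp continuous_fst)
      ((continuous_eval_const q).comp continuous_fst)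
  · exact isClosed_hasFDerivAt.preimage
      (f := fun J : JetSpace => (J.1, J.2.1)) (by fun_prop)
  · exact isClosed_hasFDerivAt.preimage
      (f := fun J : JetSpace => (J.2.1, J.2.2)) (by fun_prop)

theorem isClosedEmbedding_jet : IsClosedEmbedding jet :=
  ⟨⟨⟨rfl⟩, jet_injective⟩, isClosed_range_jet⟩

theorem polishSpace_continuousMap (F : Type*) [NormedAddCommGroup F] [CompleteSpace F]
    [SecondCountableTopology F] : PolishSpace C(ℝ × ℝ, F) := inferInstance

instance : PolishSpace VectorField :=
  have := polishSpace_continuousMap (ℝ × ℝ)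
  have := polishSpace_continuousMap ((ℝ × ℝ) →L[ℝ] (ℝ × ℝ))
  have := polishSpace_continuousMap ((ℝ × ℝ) →L[ℝ] ((ℝ × ℝ) →L[ℝ] (ℝ × ℝ)))
  isClosedEmbedding_jet.polishSpace

/-- `c : ℝ → T²` is a trajectory of `v`, that is, a solution of `ċ = v(c)` on the whole real line
(all solutions extend to it, because the torus is compact). The derivative is taken in the
covering plane. -/
def IsTrajectory (v : VectorField) (c : ℝ → Torus) : Prop :=
  ∃ l : ℝ → ℝ × ℝ, (∀ t, proj (l t) = c t) ∧ ∀ t, HasDerivAt l (v.toFun (c t)) t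

/-- `c : ℝ → T²` runs along an orbit of `v` in the direction of time: it becomes a trajectory after
an increasing bijective change of time `ℝ → ℝ`. -/
def IsOrientedOrbit (v : VectorField) (c : ℝ → Torus) : Prop :=
  ∃ τ : ℝ ≃o ℝ, IsTrajectory v (c ∘ τ)

/-- Orbital topological equivalence of `v` and `w`: some homeomorphism `H` of the torus, homotopic
to the identity, takes the orbits of `v` to the orbits of `w` (so that `H⁻¹` takes the orbits of
`w` to those of `v`), preserving the time orientation. -/
def OrbitallyEquivalent (v w : VectorField) : Prop :=
  ∃ H : Torus ≃ₜ Torus,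
    ContinuousMap.Homotopic (H : C(Torus, Torus)) (ContinuousMap.id Torus) ∧
      ∀ c : ℝ → Torus, IsOrientedOrbit v c ↔ IsOrientedOrbit w (H ∘ c)

/-- Orbital topological equivalence, as an equivalence relation on `𝒱²(T²)`. -/
def orbitalEquivalence : Setoid VectorField where
  r := OrbitallyEquivalent
  iseqv := by
    refine ⟨fun v => ⟨Homeomorph.refl _, ContinuousMap.Homotopic.refl _, fun c => Iff.rfl⟩, ?_, ?_⟩
    · rintro v w ⟨H, h, hc⟩
      refine ⟨H.symm, ?_, fun c => ?_⟩
      · have h1 := (ContinuousMap.Homotopic.refl (H.symm : C(Torus, Torus))).comp h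
        have e : (H.symm : C(Torus, Torus)).comp (H : C(Torus, Torus)) = ContinuousMap.id _ := by
          ext1 x
          simp
        rw [e, ContinuousMap.comp_id] at h1
        exact h1.symm
      · have e : H ∘ (H.symm ∘ c) = c := by
          funext t
          simp
        rw [hc (H.symm ∘ c), e]
    · rintro u v w ⟨H, h, hc⟩ ⟨K, k, kc⟩
      refine ⟨H.trans K, ?_, fun c => (hc c).trans (kc (H ∘ c))⟩
      have h1 := k.comp h
      rw [ContinuousMap.comp_id] at h1
      exact h1

end VectorField

/-- A family `v_ρ`, `ρ ∈ ℝ/ℤ`, of vector fields on the torus is smooth: its value `v_ρ(x, y)` is a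
`C^∞` function of the parameter and the point together. -/
def IsSmoothFamily (v : UnitAddCircle → VectorField) : Prop :=
  ContDiff ℝ ∞ (fun p : ℝ × (ℝ × ℝ) => (v (p.1 : UnitAddCircle)).lift p.2)

/-- A map between topological spaces is Borel: preimages of open sets are Borel sets. -/
def IsBorelMap {X Y : Type*} [TopologicalSpace X] [TopologicalSpace Y] (f : X → Y) : Prop :=
  ∀ A : Set Y, IsOpen A → @MeasurableSet X (borel X) (f ⁻¹' A)

/-- `f` is a Borel reduction of the equivalence relation `E` on the Polish space `X` to the
equivalence relation `F` on the Polish space `Y`. -/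
def IsBorelReduction {X Y : Type*} [TopologicalSpace X] [PolishSpace X] [TopologicalSpace Y]
    [PolishSpace Y] (E : Setoid X) (F : Setoid Y) (f : X → Y) : Prop :=
  IsBorelMap f ∧ ∀ x₁ x₂ : X, E x₁ x₂ ↔ F (f x₁) (f x₂)

/-- The equivalence relation `E_φ` on the circle `ℝ/ℤ`: `x ∼ y` when `x = y + nφ mod 1` for some
integer `n`. -/
def rotationRel (φ : ℝ) : Setoid UnitAddCircle where
  r x y := ∃ n : ℤ, x = y + n • (φ : UnitAddCircle)
  iseqv := by
    refine ⟨fun x => ⟨0, by simp⟩, ?_, ?_⟩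
    · rintro x y ⟨n, rfl⟩
      exact ⟨-n, by simp⟩
    · rintro x y z ⟨n, rfl⟩ ⟨m, rfl⟩
      exact ⟨m + n, by rw [add_smul, add_assoc]⟩

/-- The circle without the points `nφ mod 1`, `n ∈ ℤ`. -/
def OffOrbit (φ : ℝ) : Type := {x : UnitAddCircle // ∀ n : ℤ, x ≠ n • (φ : UnitAddCircle)}

instance (φ : ℝ) : TopologicalSpace (OffOrbit φ) :=
  inferInstanceAs (TopologicalSpace {x : UnitAddCircle // ∀ n : ℤ, x ≠ n • (φ : UnitAddCircle)})

instance (φ : ℝ) : PolishSpace (OffOrbit φ) := by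
  have hP : ∀ n : ℤ, PolishSpace {x : UnitAddCircle // x ≠ n • (φ : UnitAddCircle)} := fun n =>
    (isOpen_ne (x := n • (φ : UnitAddCircle))).polishSpace
  let g : OffOrbit φ → ∀ n : ℤ, {x : UnitAddCircle // x ≠ n • (φ : UnitAddCircle)} :=
    fun x n => ⟨x.1, x.2 n⟩
  have hval : Continuous (fun x : OffOrbit φ => x.1) := continuous_subtype_val
  have hg : Continuous g := continuous_pi fun n => hval.subtype_mk _
  have hr : range g = {f | ∀ n, (f n).1 = (f 0).1} := by
    ext f
    constructor
    · rintro ⟨x, rfl⟩ n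
      rfl
    · intro hf
      exact ⟨⟨(f 0).1, fun n => hf n ▸ (f n).2⟩, funext fun n => Subtype.ext (hf n).symm⟩
  have hcl : IsClosed (range g) := by
    rw [hr]
    simp only [ofPred_forall]
    exact isClosed_iInter fun n => isClosed_eq (continuous_subtype_val.comp (continuous_apply n))
      (continuous_subtype_val.comp (continuous_apply 0))
  have hind : IsInducing g := by
    have h : IsInducing ((fun f : ∀ n : ℤ, {x : UnitAddCircle // x ≠ n • (φ : UnitAddCircle)} =>
        (f 0).1) ∘ g) := IsInducing.subtypeVal
    exact IsInducing.of_comp hg (continuous_subtype_val.comp (continuous_apply 0)) h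
  have hinj : Function.Injective g := fun x y h =>
    Subtype.ext (congrArg (fun f => (f 0).1) h)
  exact IsClosedEmbedding.polishSpace ⟨⟨hind, hinj⟩, hcl⟩

/-- The restriction of `E_φ` to the circle without the points `nφ mod 1`. -/
def rotationRelOff (φ : ℝ) : Setoid (OffOrbit φ) := (rotationRel φ).comap Subtype.val

end TorusField

/-!
The field `v_ρ` is the linear field `(φ, 1)` on the torus, slowed down by a smooth factor `speed φ ρ`
that is positive except at three points: the origin and `flow φ (1 / 2)`, which lie on the same leaf
of the linear flow, and the moving point `(ρ, 0)`, which lies on another leaf as long as `ρ` is not a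
multiple of `φ`. Two parameters differ by a multiple of `φ` exactly when their moving zeros lie on the
same leaf, so that the task is to recover the leaf of the moving zero from the topology of the
oriented orbits.

If the moving zeros of `v_ρ₁` and `v_ρ₂` lie on the same leaf, one is slid to the other along it: the
map `q ↦ q + flow φ (u q)` is a homeomorphism homotopic to the identity as soon as `u` varies along
the leaves more slowly than time (`exists_homeomorph_slide`), and `u` can be chosen to vanish at the
other two zeros (`exists_slide_time`). Such a slide is an orbital equivalence because the oriented
orbits have a description without derivatives (`isOrientedOrbit_alongField_iff`): they are the zeros
and the maximal intervals without zeros on the leaves. That such an interval is a single orbit,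
traversed in infinite time, follows from global existence and uniqueness for a bounded Lipschitz
field on the line.

Conversely, let `H` be an orbital equivalence homotopic to the identity. Its displacement
`H q - q` lifts to a continuous map `T² → ℝ²` (`exists_displacement`). The component of the lift
transversal to the leaves is constant along any leaf without zeros, which is a single orbit; as this
leaf is dense, the component is constant on the torus. So `H` acts on the leaves as a translation
(`exists_translation_of_orbitallyEquivalent`). It takes the three zeros of `v_ρ₁` to those of
`v_ρ₂`, and one of the two zeros on the leaf of the origin has to stay on that leaf; the translation
therefore fixes every leaf, and the moving zeros lie on the same one.

The Borel reduction is even continuous, because a family that is smooth in the parameter and the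
point together is continuous for the `C²` topology (`IsSmoothFamily.continuous`).
-/

namespace TorusField

open scoped NNReal

/-! ### Orbits of autonomous equations on the line -/

/-- A bounded Lipschitz field on the line has solutions for all time. -/
theorem exists_global_solution {g : ℝ → ℝ} {K C : ℝ≥0} (hK : LipschitzWith K g)
    (hC : ∀ s, ‖g s‖ ≤ C) (x₀ : ℝ) :
    ∃ σ : ℝ → ℝ, σ 0 = x₀ ∧ ∀ t, HasDerivAt σ (g (σ t)) t := by
  have loc : ∀ n : ℕ, ∃ σ : ℝ → ℝ, σ 0 = x₀ ∧
      ∀ t ∈ Ioo (-(n : ℝ) - 1) (n + 1), HasDerivAt σ (g (σ t)) t := by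
    intro n
    have hn : (0 : ℝ) ≤ n := n.cast_nonneg
    have h0 : (0 : ℝ) ∈ Icc (-(n : ℝ) - 1) (n + 1) := ⟨by linarith, by linarith⟩
    have hP : IsPicardLindelof (fun _ => g) (⟨0, h0⟩ : Icc (-(n : ℝ) - 1) (n + 1)) x₀
        (C * (n + 1)) 0 C K := by
      refine IsPicardLindelof.of_time_independent (fun x _ => hC x) hK.lipschitzOnWith ?_
      have h1 : max ((n : ℝ) + 1 - 0) (0 - (-(n : ℝ) - 1)) = n + 1 := by
        rw [max_eq_left] <;> linarith
      rw [h1]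
      simp
    obtain ⟨σ, h0, h⟩ := hP.exists_eq_forall_mem_Icc_hasDerivWithinAt₀
    exact ⟨σ, h0, fun t ht => (h t (Ioo_subset_Icc_self ht)).hasDerivAt (Icc_mem_nhds ht.1 ht.2)⟩
  choose σ h0 h using loc
  have hmem : ∀ t : ℝ, t ∈ Ioo (-(⌈|t|⌉₊ : ℝ) - 1) (⌈|t|⌉₊ + 1) := fun t => by
    have h1 := Nat.le_ceil |t|
    have h2 := abs_le.1 h1
    constructor <;> linarith [h2.1, h2.2]
  -- solutions on nested intervals agree, so that they glue
  have agree : ∀ m n : ℕ, m ≤ n → EqOn (σ m) (σ n) (Ioo (-(m : ℝ) - 1) (m + 1)) := by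
    intro m n hmn
    have hmn' : (m : ℝ) ≤ n := by exact_mod_cast hmn
    have hm : (0 : ℝ) ≤ m := m.cast_nonneg
    refine ODE_solution_unique_of_mem_Ioo (v := fun _ => g) (s := fun _ => univ) (K := K) (t₀ := 0)
      (fun _ _ => hK.lipschitzOnWith) ⟨by linarith, by linarith⟩
      (fun t ht => ⟨h m t ht, mem_univ _⟩) (fun t ht => ⟨h n t ?_, mem_univ _⟩)
      ((h0 m).trans (h0 n).symm)
    exact ⟨by linarith [ht.1], by linarith [ht.2]⟩
  have agree' : ∀ (n : ℕ) (t : ℝ), t ∈ Ioo (-(n : ℝ) - 1) (n + 1) → σ ⌈|t|⌉₊ t = σ n t := by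
    intro n t ht
    rcases le_total ⌈|t|⌉₊ n with hle | hle
    · exact agree _ _ hle (hmem t)
    · exact (agree _ _ hle ht).symm
  refine ⟨fun t => σ ⌈|t|⌉₊ t, h0 _, fun t => ?_⟩
  refine (h ⌈|t|⌉₊ t (hmem t)).congr_of_eventuallyEq ?_
  filter_upwards [isOpen_Ioo.mem_nhds (hmem t)] with s hs
  exact agree' _ _ hs

/-- `θ` runs through an orbit of `ẋ = g(x)` on the line, for a field `g ≥ 0`, at an arbitrary speed:
either it rests at a zero of `g`, or it increases from one end to the other of an interval on which
`g` does not vanish and which is maximal with this property. -/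
def IsOrbitParam (g θ : ℝ → ℝ) : Prop :=
  ((∀ t, θ t = θ 0) ∧ g (θ 0) = 0) ∨
    (StrictMono θ ∧ Continuous θ ∧ range θ = ordConnectedComponent {s | g s ≠ 0} (θ 0))

theorem isOrbitParam_of_solution {g : ℝ → ℝ} {K : ℝ≥0} (hK : LipschitzWith K g) (hg : ∀ s, 0 ≤ g s)
    {σ : ℝ → ℝ} (hσ : ∀ t, HasDerivAt σ (g (σ t)) t) : IsOrbitParam g σ := by
  have hcont : Continuous σ := continuous_iff_continuousAt.2 fun t => (hσ t).continuousAt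
  by_cases hz : ∃ t, g (σ t) = 0
  · obtain ⟨t₀, ht₀⟩ := hz
    have hc : σ = fun _ => σ t₀ :=
      ODE_solution_unique_univ (v := fun _ => g) (s := fun _ => univ) (K := K) (t₀ := t₀)
        (fun _ => hK.lipschitzOnWith) (fun t => ⟨hσ t, mem_univ _⟩)
        (fun t => ⟨by rw [ht₀]; exact hasDerivAt_const _ _, mem_univ _⟩) rfl
    have hc' : ∀ t, σ t = σ t₀ := fun t => congrFun hc t
    exact Or.inl ⟨fun t => (hc' t).trans (hc' 0).symm, by rw [hc' 0, ht₀]⟩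
  · push Not at hz
    have hpos : ∀ t, 0 < g (σ t) := fun t => (hg _).lt_of_ne (hz t).symm
    have hmono : StrictMono σ :=
      strictMono_of_deriv_pos fun t => by rw [(hσ t).deriv]; exact hpos t
    refine Or.inr ⟨hmono, hcont, ?_⟩
    have hconn : OrdConnected (range σ) := (isPreconnected_range hcont).ordConnected
    apply Subset.antisymm
    · exact subset_ordConnectedComponent (mem_range_self 0) (by rintro _ ⟨t, rfl⟩; exact hz t)
    · intro s hs
      rw [mem_ordConnectedComponent] at hs
      -- the field has a positive lower bound between `σ 0` and `s`, so that the solution, run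
      -- forwards or backwards, reaches `s` in finite time
      obtain ⟨z, hz1, hz2⟩ := isCompact_uIcc.exists_isMinOn (nonempty_uIcc (a := σ 0) (b := s))
        hK.continuous.continuousOn
      have hm : 0 < g z := (hg z).lt_of_ne (hs hz1).symm
      have hmin : ∀ x ∈ uIcc (σ 0) s, g z ≤ g x := fun x hx => hz2 hx
      by_contra hns
      rcases le_total (σ 0) s with h0 | h0
      · have hlt : ∀ t, σ t < s := by
          intro t
          by_contra! hts
          exact hns (hconn.out (mem_range_self 0) (mem_range_self t) ⟨h0, hts⟩)
        have hT : 0 ≤ (s - σ 0) / g z := div_nonneg (by linarith) hm.le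
        have key := Convex.mul_sub_le_image_sub_of_le_deriv (convex_Ici (0 : ℝ)) (f := σ)
          hcont.continuousOn (fun t _ => (hσ t).differentiableAt.differentiableWithinAt)
          (C := g z) (fun t ht => by
            rw [interior_Ici, mem_Ioi] at ht
            rw [(hσ t).deriv]
            exact hmin _ (by rw [uIcc_of_le h0]; exact ⟨hmono.monotone ht.le, (hlt t).le⟩))
          0 self_mem_Ici _ hT hT
        rw [sub_zero, mul_div_cancel₀ _ hm.ne'] at key
        linarith [hlt ((s - σ 0) / g z)]
      · have hlt : ∀ t, s < σ t := by
          intro t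
          by_contra! hts
          exact hns (hconn.out (mem_range_self t) (mem_range_self 0) ⟨hts, h0⟩)
        have hT : -((σ 0 - s) / g z) ≤ 0 := neg_nonpos.2 (div_nonneg (by linarith) hm.le)
        have key := Convex.mul_sub_le_image_sub_of_le_deriv (convex_Iic (0 : ℝ)) (f := σ)
          hcont.continuousOn (fun t _ => (hσ t).differentiableAt.differentiableWithinAt)
          (C := g z) (fun t ht => by
            rw [interior_Iic, mem_Iio] at ht
            rw [(hσ t).deriv]
            exact hmin _ (by rw [uIcc_of_ge h0]; exact ⟨(hlt t).le, hmono.monotone ht.le⟩))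
          _ hT 0 self_mem_Iic hT
        rw [sub_neg_eq_add, zero_add, mul_div_cancel₀ _ hm.ne'] at key
        linarith [hlt (-((σ 0 - s) / g z))]

/-- `IsOrbitParam` is the geometric form of being a solution of `ẋ = g(x)` up to an increasing
change of time. -/
theorem isOrbitParam_iff {g : ℝ → ℝ} {K C : ℝ≥0} (hK : LipschitzWith K g)
    (hC : ∀ s, ‖g s‖ ≤ C) (hg : ∀ s, 0 ≤ g s) (θ : ℝ → ℝ) :
    IsOrbitParam g θ ↔ ∃ τ : ℝ ≃o ℝ, ∀ t, HasDerivAt (θ ∘ τ) (g (θ (τ t))) t := by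
  constructor
  · rintro (⟨hc, h0⟩ | ⟨hmono, -, hr⟩)
    · refine ⟨OrderIso.refl ℝ, fun t => ?_⟩
      have e : θ ∘ OrderIso.refl ℝ = fun _ => θ 0 := funext hc
      have e' : g (θ (OrderIso.refl ℝ t)) = 0 := by rw [hc, h0]
      rw [e, e']
      exact hasDerivAt_const _ _
    · obtain ⟨σ, h0, hσ⟩ := exists_global_solution hK hC (θ 0)
      have hne : g (θ 0) ≠ 0 := by
        have : θ 0 ∈ ordConnectedComponent {s | g s ≠ 0} (θ 0) := hr ▸ mem_range_self 0
        exact ordConnectedComponent_subset this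
      rcases isOrbitParam_of_solution hK hg hσ with ⟨-, hz⟩ | ⟨hmono', -, hr'⟩
      · exact absurd (h0 ▸ hz) hne
      · have hrr : range σ = range θ := by rw [hr, hr', h0]
        let τ : ℝ ≃o ℝ := ((hmono'.orderIso σ).trans (OrderIso.setCongr _ _ hrr)).trans
          (hmono.orderIso θ).symm
        have hτ : ∀ t, θ (τ t) = σ t := fun t =>
          congrArg Subtype.val ((hmono.orderIso θ).apply_symm_apply
            (OrderIso.setCongr _ _ hrr (hmono'.orderIso σ t)))
        refine ⟨τ, fun t => ?_⟩
        rw [hτ, show θ ∘ τ = σ from funext hτ]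
        exact hσ t
  · rintro ⟨τ, hτ⟩
    have key : ∀ t, θ t = (θ ∘ τ) (τ.symm t) := fun t => by simp
    rcases isOrbitParam_of_solution hK hg hτ with ⟨hc, hz⟩ | ⟨hmono, hcont, hr⟩
    · have h0 : ∀ t, θ t = (θ ∘ τ) 0 := fun t => by rw [key, hc]
      exact Or.inl ⟨fun t => (h0 t).trans (h0 0).symm, by rw [h0]; exact hz⟩
    · have e : θ = (θ ∘ τ) ∘ τ.symm := funext key
      have hr2 : range θ = ordConnectedComponent {s | g s ≠ 0} ((θ ∘ τ) 0) := by
        rw [← hr, τ.surjective.range_comp]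
      refine Or.inr ⟨by rw [e]; exact hmono.comp τ.symm.strictMono,
        by rw [e]; exact hcont.comp τ.symm.continuous, hr2.trans ?_⟩
      apply ordConnectedComponent_eq
      rw [← mem_ordConnectedComponent, ← hr2]
      exact mem_range_self 0

theorem IsOrbitParam.comp_orderIso {g₁ g₂ θ : ℝ → ℝ} (k : ℝ ≃o ℝ)
    (hk : ∀ s, g₂ (k s) = 0 ↔ g₁ s = 0) (h : IsOrbitParam g₁ θ) : IsOrbitParam g₂ (k ∘ θ) := by
  rcases h with ⟨hc, hz⟩ | ⟨hmono, hcont, hr⟩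
  · exact Or.inl ⟨fun t => congrArg k (hc t), (hk _).2 hz⟩
  · refine Or.inr ⟨k.strictMono.comp hmono, k.continuous.comp hcont, ?_⟩
    rw [range_comp, hr]
    ext y
    obtain ⟨x, rfl⟩ := k.surjective y
    rw [k.injective.mem_set_image, mem_ordConnectedComponent, mem_ordConnectedComponent]
    constructor
    · intro h z hz
      obtain ⟨w, rfl⟩ := k.surjective z
      simp only [mem_uIcc, Function.comp, k.le_iff_le] at hz
      exact (hk w).not.2 (h (mem_uIcc.2 hz))
    · intro h w hw
      refine (hk w).not.1 (h ?_)
      simpa only [mem_uIcc, Function.comp, k.le_iff_le] using hw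

/-! ### Vector fields along the linear flow -/

/-- The orbit through the origin of the linear flow of slope `φ`, as a homomorphism `ℝ → T²`; the
flow itself is `(s, q) ↦ q + flow φ s`. -/
def flow (φ : ℝ) : ℝ →+ Torus where
  toFun s := (((s * φ : ℝ) : UnitAddCircle), ((s : ℝ) : UnitAddCircle))
  map_zero' := by simp
  map_add' s t := by simp [add_mul]

theorem proj_add (p q : ℝ × ℝ) : proj (p + q) = proj p + proj q := by
  simp [proj]

theorem proj_flow (φ s : ℝ) : proj (s * φ, s) = flow φ s := rfl

theorem continuous_flow (φ : ℝ) : Continuous (flow φ) :=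
  continuous_proj.comp (f := fun s : ℝ => (s * φ, s)) (by fun_prop)

theorem isOpenQuotientMap_proj : IsOpenQuotientMap proj :=
  (QuotientAddGroup.isOpenQuotientMap_mk (N := AddSubgroup.zmultiples (1 : ℝ))).prodMap
    (QuotientAddGroup.isOpenQuotientMap_mk (N := AddSubgroup.zmultiples (1 : ℝ)))

/-- The field `f · (φ, 1)`, a rescaling of the linear field of slope `φ`. -/
def alongField (φ : ℝ) (f : Torus → ℝ) (hf : ContDiff ℝ 2 fun p => f (proj p)) : VectorField where
  toFun q := (f q * φ, f q)
  contDiff_lift := (hf.mul contDiff_const).prodMk hf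

theorem continuous_of_contDiff_lift {f : Torus → ℝ} (hf : ContDiff ℝ 2 fun p => f (proj p)) :
    Continuous f :=
  isOpenQuotientMap_proj.isQuotientMap.continuous_iff.2 hf.continuous

theorem exists_lipschitzWith_lift {f : Torus → ℝ} (hf : ContDiff ℝ 2 fun p => f (proj p)) :
    ∃ K : NNReal, LipschitzWith K fun p => f (proj p) := by
  have hd : Continuous fun p => fderiv ℝ (fun p => f (proj p)) p :=
    hf.continuous_fderiv (by norm_num)
  -- the derivative is periodic, so that its bound on the unit square is a global one
  obtain ⟨K, hK⟩ := (isCompact_Icc (a := ((0 : ℝ), (0 : ℝ)))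
    (b := (1, 1))).exists_bound_of_continuousOn hd.continuousOn
  refine ⟨K.toNNReal, lipschitzWith_of_nnnorm_fderiv_le (𝕜 := ℝ) (hf.differentiable (by norm_num))
    fun p => ?_⟩
  let r : ℝ × ℝ := (Int.fract p.1, Int.fract p.2)
  have hr : proj (p - r) = 0 := by
    simp [proj, r]
  have hshift : (fun p => f (proj p)) = fun x => f (proj (x + (p - r))) := by
    funext x
    rw [proj_add, hr, add_zero]
  have e : fderiv ℝ (fun p => f (proj p)) p = fderiv ℝ (fun p => f (proj p)) r := by
    conv_rhs => rw [hshift]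
    rw [fderiv_comp_add_right (f := fun p => f (proj p))]
    simp
  rw [e, ← NNReal.coe_le_coe, coe_nnnorm]
  refine (hK r ?_).trans (Real.le_coe_toNNReal K)
  exact ⟨⟨Int.fract_nonneg _, Int.fract_nonneg _⟩,
    ⟨(Int.fract_lt_one _).le, (Int.fract_lt_one _).le⟩⟩

theorem exists_bounds_along_flow {φ : ℝ} {f : Torus → ℝ}
    (hf : ContDiff ℝ 2 fun p => f (proj p)) (q : Torus) :
    ∃ K C : NNReal, LipschitzWith K (fun s => f (q + flow φ s)) ∧
      ∀ s, ‖f (q + flow φ s)‖ ≤ C := by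
  obtain ⟨p, rfl⟩ := proj_surjective q
  obtain ⟨K, hK⟩ := exists_lipschitzWith_lift hf
  have hlin : LipschitzWith (Real.nnabs φ + 1) fun s : ℝ => p + (s * φ, s) := by
    refine LipschitzWith.of_dist_le_mul fun s t => ?_
    rw [dist_add_left, Prod.dist_eq, Real.dist_eq, Real.dist_eq, ← sub_mul, abs_mul]
    have h1 := abs_nonneg (s - t)
    have h2 := abs_nonneg φ
    push_cast
    refine max_le ?_ ?_ <;> nlinarith [mul_nonneg h1 h2]
  obtain ⟨C, hC⟩ := isCompact_univ.exists_bound_of_continuousOn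
    (continuous_of_contDiff_lift hf).continuousOn
  refine ⟨_, C.toNNReal, hK.comp hlin, fun s => (hC _ (mem_univ _)).trans (Real.le_coe_toNNReal C)⟩

/-- The oriented orbits of a field `f · (φ, 1)` with `f ≥ 0`: such an orbit lies on a leaf
`s ↦ q + flow φ s` of the linear flow, and is an orbit of the restriction of `f` to it. -/
theorem isOrientedOrbit_alongField_iff {φ : ℝ} {f : Torus → ℝ}
    (hf : ContDiff ℝ 2 fun p => f (proj p)) (h0 : ∀ q, 0 ≤ f q) (c : ℝ → Torus) :
    (alongField φ f hf).IsOrientedOrbit c ↔ ∃ (q : Torus) (θ : ℝ → ℝ),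
      (∀ t, c t = q + flow φ (θ t)) ∧ IsOrbitParam (fun s => f (q + flow φ s)) θ := by
  constructor
  · rintro ⟨τ, l, hl, hd⟩
    have hd1 : ∀ t, HasDerivAt (fun t => (l t).1) (f (c (τ t)) * φ) t := fun t => (hd t).fst
    have hd2 : ∀ t, HasDerivAt (fun t => (l t).2) (f (c (τ t))) t := fun t => (hd t).snd
    have hconst : ∀ t, (l t).1 - (l t).2 * φ = (l 0).1 - (l 0).2 * φ := by
      have hd3 : ∀ t, HasDerivAt (fun t => (l t).1 - (l t).2 * φ) 0 t := fun t => by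
        simpa using (hd1 t).fun_sub ((hd2 t).mul_const φ)
      exact fun t => is_const_of_deriv_eq_zero (fun t => (hd3 t).differentiableAt)
        (fun t => (hd3 t).deriv) t 0
    have hlt : ∀ t, c (τ t) = proj ((l 0).1 - (l 0).2 * φ, 0) + flow φ (l t).2 := by
      intro t
      rw [← Function.comp_apply (f := c), ← hl t, ← proj_flow, ← proj_add, ← hconst t]
      simp
    refine ⟨proj ((l 0).1 - (l 0).2 * φ, 0), fun t => (l (τ.symm t)).2, fun t => ?_, ?_⟩
    · rw [← hlt, τ.apply_symm_apply]
    · obtain ⟨K, C, hK, hC⟩ := exists_bounds_along_flow (φ := φ) hf (proj ((l 0).1 - (l 0).2 * φ, 0))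
      refine (isOrbitParam_iff hK hC (fun s => h0 _) _).2 ⟨τ, fun t => ?_⟩
      have e : (fun t => (l (τ.symm t)).2) ∘ τ = fun t => (l t).2 := by
        funext t
        simp
      rw [e, τ.symm_apply_apply, ← hlt]
      exact hd2 t
  · rintro ⟨q, θ, hc, hθ⟩
    obtain ⟨p, rfl⟩ := proj_surjective q
    obtain ⟨K, C, hK, hC⟩ := exists_bounds_along_flow (φ := φ) hf (proj p)
    obtain ⟨τ, hτ⟩ := (isOrbitParam_iff hK hC (fun s => h0 _) _).1 hθ
    refine ⟨τ, fun t => p + (θ (τ t) * φ, θ (τ t)), fun t => ?_, fun t => ?_⟩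
    · rw [proj_add, proj_flow, Function.comp_apply, hc]
    · refine HasDerivAt.const_add p ?_
      change HasDerivAt _ (f (c (τ t)) * φ, f (c (τ t))) t
      rw [hc]
      exact ((hτ t).mul_const φ).prodMk (hτ t)

/-! ### Sliding along the leaves -/

theorem exists_orderIso_slide {φ : ℝ} {u : Torus → ℝ} (hu : Continuous u) {κ : ℝ} (hκ : κ < 1)
    (hlip : ∀ q r, |u (q + flow φ r) - u q| ≤ κ * |r|) (q : Torus) :
    ∃ k : ℝ ≃o ℝ, ∀ s, k s = s + u (q + flow φ s) := by
  have hcont : Continuous fun s => s + u (q + flow φ s) := by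
    have := continuous_flow φ
    fun_prop
  have hmono : StrictMono fun s => s + u (q + flow φ s) := by
    intro s t hst
    have h := hlip (q + flow φ s) (t - s)
    rw [add_assoc, ← map_add, add_sub_cancel, abs_of_pos (sub_pos.2 hst)] at h
    have h2 := (abs_le.1 h).1
    have h3 : κ * (t - s) < 1 * (t - s) := mul_lt_mul_of_pos_right hκ (sub_pos.2 hst)
    change s + _ < t + _
    linarith
  obtain ⟨C, hC⟩ := isCompact_univ.exists_bound_of_continuousOn hu.continuousOn
  have hC' : ∀ q, -C ≤ u q ∧ u q ≤ C := fun q => abs_le.1 (hC q (mem_univ q))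
  have hsurj : Function.Surjective fun s => s + u (q + flow φ s) := by
    refine hcont.surjective ?_ ?_
    · exact tendsto_atTop_mono (fun s => add_le_add_right (hC' _).1 s)
        (tendsto_atTop_add_const_right _ (-C) tendsto_id)
    · exact tendsto_atBot_mono (fun s => add_le_add_right (hC' _).2 s)
        (tendsto_atBot_add_const_right _ C tendsto_id)
  exact ⟨hmono.orderIsoOfSurjective _ hsurj, fun s => rfl⟩

/-- Moving each point `q` along its leaf by the time `u q` is a homeomorphism of the torus, provided
that `u` varies along the leaves more slowly than time. -/
theorem exists_homeomorph_slide {φ : ℝ} {u : Torus → ℝ} (hu : Continuous u) {κ : ℝ} (hκ : κ < 1)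
    (hlip : ∀ q r, |u (q + flow φ r) - u q| ≤ κ * |r|) :
    ∃ H : Torus ≃ₜ Torus, ∀ q, H q = q + flow φ (u q) := by
  have hcont : Continuous fun q => q + flow φ (u q) :=
    continuous_id.add ((continuous_flow φ).comp hu)
  have hinj : Function.Injective fun q => q + flow φ (u q) := by
    intro q q' h
    have e : q' = q + flow φ (u q - u q') := by
      rw [map_sub, ← add_sub_assoc, eq_sub_iff_add_eq]
      exact h.symm
    have h1 := hlip q (u q - u q')
    rw [← e, abs_sub_comm] at h1
    have h2 : |u q - u q'| = 0 := by nlinarith [abs_nonneg (u q - u q')]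
    rw [e, abs_eq_zero.1 h2, map_zero, add_zero]
  have hsurj : Function.Surjective fun q => q + flow φ (u q) := by
    intro q
    obtain ⟨k, hk⟩ := exists_orderIso_slide hu hκ hlip q
    obtain ⟨s, hs⟩ := k.surjective 0
    refine ⟨q + flow φ s, ?_⟩
    change q + flow φ s + flow φ (u (q + flow φ s)) = q
    rw [add_assoc, ← map_add, ← hk, hs, map_zero, add_zero]
  let E : Torus ≃ Torus := Equiv.ofBijective _ ⟨hinj, hsurj⟩
  exact ⟨Continuous.homeoOfEquivCompactToT2 (f := E) hcont, fun q => rfl⟩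

/-- A slide along the leaves that takes the zeros of `f₁` to the zeros of `f₂` is an orbital
equivalence of the corresponding fields. -/
theorem orbitallyEquivalent_of_slide {φ : ℝ} {f₁ f₂ : Torus → ℝ}
    (hf₁ : ContDiff ℝ 2 fun p => f₁ (proj p)) (hf₂ : ContDiff ℝ 2 fun p => f₂ (proj p))
    (h₁ : ∀ q, 0 ≤ f₁ q) (h₂ : ∀ q, 0 ≤ f₂ q)
    {u : Torus → ℝ} (hu : Continuous u) {κ : ℝ} (hκ : κ < 1)
    (hlip : ∀ q r, |u (q + flow φ r) - u q| ≤ κ * |r|)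
    (hz : ∀ q, f₂ (q + flow φ (u q)) = 0 ↔ f₁ q = 0) :
    (alongField φ f₁ hf₁).OrbitallyEquivalent (alongField φ f₂ hf₂) := by
  obtain ⟨H, hH⟩ := exists_homeomorph_slide hu hκ hlip
  refine ⟨H, ⟨⟨⟨fun x => x.2 + flow φ ((1 - (x.1 : ℝ)) * u x.2), ?_⟩, fun q => ?_, fun q => ?_⟩⟩,
    fun c => ?_⟩
  -- the homotopy to the identity scales the time of the slide down to zero
  · exact continuous_snd.add ((continuous_flow φ).comp (by fun_prop))
  · simp [hH]
  · simp
  rw [isOrientedOrbit_alongField_iff hf₁ h₁, isOrientedOrbit_alongField_iff hf₂ h₂]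
  refine exists_congr fun q => ?_
  obtain ⟨k, hk⟩ := exists_orderIso_slide hu hκ hlip q
  have hHk : ∀ s, H (q + flow φ s) = q + flow φ (k s) := fun s => by
    rw [hH, hk, map_add, add_assoc]
  have hkz : ∀ s, f₂ (q + flow φ (k s)) = 0 ↔ f₁ (q + flow φ s) = 0 := fun s => by
    rw [← hHk, hH, hz]
  constructor
  · rintro ⟨θ, hc, hθ⟩
    exact ⟨k ∘ θ, fun t => by rw [Function.comp_apply, hc, hHk, Function.comp_apply],
      hθ.comp_orderIso k hkz⟩
  · rintro ⟨θ, hc, hθ⟩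
    refine ⟨k.symm ∘ θ, fun t => H.injective ?_, hθ.comp_orderIso k.symm fun s => ?_⟩
    · rw [hHk, Function.comp_apply, k.apply_symm_apply]
      exact hc t
    · rw [← hkz, k.apply_symm_apply]

/-- The length of the slide: a function with a prescribed value `T` at `a`, equal to zero on a compact
set that misses the leaf of `a`, and varying more slowly than time along the leaves. It is a truncated
multiple of the cheapest cost `D q` of travelling from `a` to `q`, where moving along the leaves costs
little, and jumping across them costs much. -/
theorem exists_slide_time (φ : ℝ) {a : Torus} {Z : Set Torus} (hZ : IsCompact Z)
    (ha : ∀ z ∈ Z, ∀ s, z ≠ a + flow φ s) (T : ℝ) :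
    ∃ u : Torus → ℝ, Continuous u ∧ u a = T ∧ (∀ z ∈ Z, u z = 0) ∧
      ∃ κ < 1, ∀ q r, |u (q + flow φ r) - u q| ≤ κ * |r| := by
  have hT : 0 < |T| + 1 := by positivity
  have hflow := continuous_flow φ
  obtain ⟨ε, hε, hεZ⟩ := ((isCompact_Icc (a := -(|T| + 1)) (b := |T| + 1)).prod hZ).exists_forall_le'
    (f := fun x : ℝ × Torus => dist x.2 (a + flow φ x.1)) (a := 0)
    (by fun_prop) (fun x hx => dist_pos.2 (ha _ hx.2 _))
  let w : Torus → ℝ → ℝ := fun q s => (|T| + 1)⁻¹ * |s| + ε⁻¹ * dist q (a + flow φ s)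
  have hw : ∀ q s, 0 ≤ w q s := fun q s => by positivity
  have hbdd : ∀ q, BddBelow (range (w q)) := fun q => ⟨0, by rintro _ ⟨s, rfl⟩; exact hw q s⟩
  let D : Torus → ℝ := fun q => ⨅ s, w q s
  have hD : ∀ q s, D q ≤ w q s := fun q s => ciInf_le (hbdd q) s
  have hDflow' : ∀ q r, D (q + flow φ r) ≤ D q + (|T| + 1)⁻¹ * |r| := by
    intro q r
    rw [← sub_le_iff_le_add]
    refine le_ciInf fun s => ?_
    have h1 := hD (q + flow φ r) (s + r)
    simp only [w] at h1 ⊢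
    rw [map_add, ← add_assoc, dist_add_right] at h1
    have h2 : (|T| + 1)⁻¹ * |s + r| ≤ (|T| + 1)⁻¹ * (|s| + |r|) :=
      mul_le_mul_of_nonneg_left (abs_add_le s r) (by positivity)
    linarith
  have hDflow : ∀ q r, |D (q + flow φ r) - D q| ≤ (|T| + 1)⁻¹ * |r| := by
    intro q r
    have h1 := hDflow' q r
    have h2 := hDflow' (q + flow φ r) (-r)
    rw [add_assoc, ← map_add, add_neg_cancel, map_zero, add_zero, abs_neg] at h2
    exact abs_sub_le_iff.2 ⟨by linarith, by linarith⟩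
  have hDcont : Continuous D := by
    refine (LipschitzWith.of_le_add_mul ⟨ε⁻¹, by positivity⟩ fun q q' => ?_).continuous
    rw [← sub_le_iff_le_add]
    refine le_ciInf fun s => ?_
    have h1 := hD q s
    have h2 : ε⁻¹ * dist q (a + flow φ s) ≤ ε⁻¹ * (dist q q' + dist q' (a + flow φ s)) :=
      mul_le_mul_of_nonneg_left (dist_triangle _ _ _) (by positivity)
    simp only [w] at h1 ⊢
    change D q - ε⁻¹ * dist q q' ≤ _
    linarith
  have hDa : D a = 0 := by
    refine le_antisymm ?_ (le_ciInf fun s => hw a s)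
    simpa [w] using hD a 0
  have hDZ : ∀ z ∈ Z, 1 ≤ D z := by
    intro z hz
    refine le_ciInf fun s => ?_
    rcases le_total |s| (|T| + 1) with hs | hs
    · have h1 : 1 ≤ ε⁻¹ * dist z (a + flow φ s) := by
        rw [inv_mul_eq_div, one_le_div hε]
        exact hεZ (s, z) ⟨abs_le.1 hs, hz⟩
      have h2 : 0 ≤ (|T| + 1)⁻¹ * |s| := by positivity
      simp only [w]
      linarith
    · have h1 : 1 ≤ (|T| + 1)⁻¹ * |s| := by
        rwa [inv_mul_eq_div, one_le_div hT]
      have h2 : 0 ≤ ε⁻¹ * dist z (a + flow φ s) := by positivity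
      simp only [w]
      linarith
  refine ⟨fun q => T * max (1 - D q) 0, by fun_prop, by simp [hDa], fun z hz => ?_,
    |T| * (|T| + 1)⁻¹, ?_, fun q r => ?_⟩
  · have h1 : max (1 - D z) 0 = 0 := max_eq_right (by linarith [hDZ z hz])
    simp only [h1, mul_zero]
  · rw [← div_eq_mul_inv, div_lt_one hT]
    linarith
  · rw [← mul_sub, abs_mul, mul_assoc]
    refine mul_le_mul_of_nonneg_left ((abs_max_sub_max_le_abs _ _ 0).trans ?_) (abs_nonneg T)
    rw [sub_sub_sub_cancel_left, abs_sub_comm]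
    exact hDflow q r

/-! ### Orbital equivalences are translations up to sliding along the leaves -/

/-- The displacement of a self-map of the torus homotopic to the identity lifts to the plane. -/
theorem exists_displacement {H : C(Torus, Torus)} (h : H.Homotopic (ContinuousMap.id Torus)) :
    ∃ d₁ d₂ : Torus → ℝ, Continuous d₁ ∧ Continuous d₂ ∧ ∀ q, H q = q + proj (d₁ q, d₂ q) := by
  obtain ⟨F⟩ := h.symm
  have key : ∀ π : C(Torus, UnitAddCircle), ∃ d : Torus → ℝ, Continuous d ∧
      ∀ q, (d q : UnitAddCircle) = π (H q) - π q := by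
    intro π
    -- lift the homotopy of displacements, which begins with the zero displacement
    let G : C(unitInterval × Torus, UnitAddCircle) :=
      ⟨fun x => π (F x) - π x.2, by fun_prop⟩
    have hG : ∀ q, G (0, q) = ((0 : ℝ) : UnitAddCircle) := fun q => by
      simp [G]
    let cov : IsCoveringMap ((↑) : ℝ → UnitAddCircle) := AddCircle.isCoveringMap_coe 1
    let Γ := cov.liftHomotopy G (ContinuousMap.const _ 0) hG
    refine ⟨fun q => Γ (1, q), by fun_prop, fun q => ?_⟩
    have := congrFun (cov.liftHomotopy_lifts G (ContinuousMap.const _ 0) hG) (1, q)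
    refine this.trans ?_
    simp [G]
  obtain ⟨d₁, h₁, e₁⟩ := key ⟨Prod.fst, continuous_fst⟩
  obtain ⟨d₂, h₂, e₂⟩ := key ⟨Prod.snd, continuous_snd⟩
  refine ⟨d₁, d₂, h₁, h₂, fun q => Prod.ext ?_ ?_⟩
  · simp only [proj, Prod.fst_add, e₁]
    simp
  · simp only [proj, Prod.snd_add, e₂]
    simp

theorem eq_of_coe_eq_const {A : ℝ → ℝ} (hA : Continuous A) {x : UnitAddCircle}
    (h : ∀ t, (A t : UnitAddCircle) = x) (s t : ℝ) : A s = A t :=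
  (AddCircle.isCoveringMap_coe (1 : ℝ)).const_of_comp hA (fun s t => (h s).trans (h t).symm) s t

/-- The leaves of the linear flow of irrational slope are dense, so that a continuous function is
determined by its values on any one of them. -/
theorem eq_of_const_on_leaf {φ : ℝ} (hφ : Irrational φ) {δ : Torus → ℝ} (hδ : Continuous δ)
    {q₀ : Torus} {β : ℝ} (h : ∀ s, δ (q₀ + flow φ s) = β) (q : Torus) : δ q = β := by
  obtain ⟨⟨x, y⟩, hp⟩ := proj_surjective (q - q₀)
  have hdense : DenseRange (· • (φ : UnitAddCircle) : ℤ → UnitAddCircle) := by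
    have := (AddCircle.denseRange_zsmul_coe_iff (a := φ) (p := 1)).2 (by simpa using hφ)
    exact this
  have hcont : Continuous fun x : UnitAddCircle => δ (q₀ + (flow φ y + (x, 0))) := by
    fun_prop
  have hfun := hdense.equalizer hcont (continuous_const (y := β)) (by
    funext n
    have e : flow φ y + (n • (φ : UnitAddCircle), 0) = flow φ (y + n) := by
      rw [map_add]
      congr 1
      have hn : ((n : ℝ) : UnitAddCircle) = 0 := (AddCircle.coe_eq_zero_iff 1).2 ⟨n, by simp⟩
      exact Prod.ext (by simp [flow]) (by simp [flow, hn])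
    simp only [Function.comp]
    rw [e, h])
  have := congrFun hfun ((x - y * φ : ℝ) : UnitAddCircle)
  rw [← this]
  congr 1
  rw [← sub_eq_iff_eq_add', ← hp]
  exact Prod.ext (by simp [flow, proj]) (by simp [flow, proj])

/-- The zeros of a field are recognised by its oriented orbits; hence an orbital equivalence takes
zeros to zeros. -/
theorem isOrientedOrbit_const_iff {φ : ℝ} {f : Torus → ℝ}
    (hf : ContDiff ℝ 2 fun p => f (proj p)) (q : Torus) :
    (alongField φ f hf).IsOrientedOrbit (fun _ => q) ↔ f q = 0 := by
  constructor
  · rintro ⟨τ, l, hl, hd⟩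
    have h2 : Continuous fun t => (l t).2 :=
      continuous_snd.comp
      (continuous_iff_continuousAt.2 fun t => (hd t).continuousAt)
    have hc : (fun t => (l t).2) = fun _ => (l 0).2 := funext fun t =>
      eq_of_coe_eq_const h2 (x := q.2) (fun t => congrArg Prod.snd (hl t)) t 0
    have hd2 : HasDerivAt (fun t => (l t).2) (f q) 0 := (hd 0).snd
    rw [hc] at hd2
    exact hd2.unique (hasDerivAt_const _ _)
  · intro h
    obtain ⟨p, rfl⟩ := proj_surjective q
    refine ⟨OrderIso.refl ℝ, fun _ => p, fun _ => rfl, fun t => ?_⟩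
    have e : (alongField φ f hf).toFun (((fun _ => proj p) ∘ OrderIso.refl ℝ) t) = 0 := by
      simp [alongField, h]
    rw [e]
    exact hasDerivAt_const _ _

/-- Rigidity: an orbital equivalence homotopic to the identity acts on the space of leaves of the
irrational linear flow as a translation. -/
theorem exists_translation_of_orbitallyEquivalent {φ : ℝ} (hφ : Irrational φ) {f₁ f₂ : Torus → ℝ}
    (hf₁ : ContDiff ℝ 2 fun p => f₁ (proj p)) (hf₂ : ContDiff ℝ 2 fun p => f₂ (proj p))
    (h₁ : ∀ q, 0 ≤ f₁ q) (h₂ : ∀ q, 0 ≤ f₂ q) {q₀ : Torus} (hq₀ : ∀ s, f₁ (q₀ + flow φ s) ≠ 0)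
    (heq : (alongField φ f₁ hf₁).OrbitallyEquivalent (alongField φ f₂ hf₂)) :
    ∃ (H : Torus ≃ₜ Torus) (b : Torus), (∀ q, f₁ q = 0 → f₂ (H q) = 0) ∧
      ∀ q, H q - (q + b) ∈ (flow φ).range := by
  obtain ⟨H, hH, hc⟩ := heq
  obtain ⟨d₁, d₂, hd₁, hd₂, hd⟩ := exists_displacement hH
  have hd' : ∀ q, H q = q + proj (d₁ q, d₂ q) := hd
  have hflow := continuous_flow φ
  -- the leaf of `q₀` is a single orbit
  have horb : (alongField φ f₁ hf₁).IsOrientedOrbit fun t => q₀ + flow φ t := by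
    refine (isOrientedOrbit_alongField_iff hf₁ h₁ _).2
      ⟨q₀, id, fun t => rfl, Or.inr ⟨strictMono_id, continuous_id, ?_⟩⟩
    have e : {s | f₁ (q₀ + flow φ s) ≠ 0} = univ := eq_univ_of_forall hq₀
    rw [e, ordConnectedComponent_univ, range_id]
  obtain ⟨q', θ, hθ, hpar⟩ := (isOrientedOrbit_alongField_iff hf₂ h₂ _).1 ((hc _).1 horb)
  have hθc : Continuous θ := by
    rcases hpar with ⟨h, -⟩ | ⟨-, h, -⟩
    · rw [show θ = fun _ => θ 0 from funext h]
      exact continuous_const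
    · exact h
  -- comparing the two lifts of the image of this orbit, the transversal displacement is constant
  have hlift : ∀ t, proj (t * φ + d₁ (q₀ + flow φ t) - θ t * φ, t + d₂ (q₀ + flow φ t) - θ t)
      = q' - q₀ := by
    intro t
    have h := hθ t
    rw [Function.comp_apply, hd', add_assoc, ← sub_eq_iff_eq_add, add_sub_assoc,
      ← eq_sub_iff_add_eq'] at h
    rw [← h]
    exact Prod.ext (by simp [flow, proj]) (by simp [flow, proj])
  have hA := eq_of_coe_eq_const (A := fun t => t * φ + d₁ (q₀ + flow φ t) - θ t * φ)
    (by fun_prop) fun t => congrArg Prod.fst (hlift t)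
  have hB := eq_of_coe_eq_const (A := fun t => t + d₂ (q₀ + flow φ t) - θ t)
    (by fun_prop) fun t => congrArg Prod.snd (hlift t)
  have hδ := eq_of_const_on_leaf hφ (δ := fun q => d₁ q - d₂ q * φ) (q₀ := q₀) (by fun_prop)
    (β := d₁ (q₀ + flow φ 0) - d₂ (q₀ + flow φ 0) * φ) fun s => by
      have h1 := hA s 0
      have h2 := hB s 0
      linear_combination h1 - φ * h2
  set β := d₁ (q₀ + flow φ 0) - d₂ (q₀ + flow φ 0) * φ
  refine ⟨H, proj (β, 0), fun q hq => ?_, fun q => ⟨d₂ q, ?_⟩⟩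
  · rw [← isOrientedOrbit_const_iff (φ := φ) hf₁] at hq
    exact (isOrientedOrbit_const_iff hf₂ _).1 ((hc _).1 hq)
  · rw [eq_sub_iff_add_eq, hd', add_left_comm, ← proj_flow, ← proj_add, ← hδ q]
    simp

/-! ### The family -/

/-- A smooth non-negative function on the torus that vanishes at the origin only, on the covering
plane. -/
noncomputable def bumpLift (p : ℝ × ℝ) : ℝ :=
  (1 - Real.cos (2 * Real.pi * p.1)) + (1 - Real.cos (2 * Real.pi * p.2))

theorem periodic_one_sub_cos : Function.Periodic (fun x : ℝ => 1 - Real.cos (2 * Real.pi * x)) 1 := by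
  intro x
  simp [mul_add]

/-- The function on the torus with lift `bumpLift`. -/
noncomputable def bump (q : Torus) : ℝ :=
  periodic_one_sub_cos.lift q.1 + periodic_one_sub_cos.lift q.2

theorem bump_proj (p : ℝ × ℝ) : bump (proj p) = bumpLift p := rfl

theorem bump_nonneg (q : Torus) : 0 ≤ bump q := by
  obtain ⟨p, rfl⟩ := proj_surjective q
  rw [bump_proj, bumpLift]
  linarith [Real.cos_le_one (2 * Real.pi * p.1), Real.cos_le_one (2 * Real.pi * p.2)]

theorem coe_eq_zero_of_cos {x : ℝ} (h : Real.cos (2 * Real.pi * x) = 1) : (x : UnitAddCircle) = 0 := by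
  obtain ⟨n, hn⟩ := (Real.cos_eq_one_iff _).1 h
  refine (AddCircle.coe_eq_zero_iff 1).2 ⟨n, ?_⟩
  have := Real.pi_pos
  rw [zsmul_one]
  exact mul_left_cancel₀ (by positivity : (2 * Real.pi) ≠ 0) (by linarith)

theorem bump_eq_zero_iff {q : Torus} : bump q = 0 ↔ q = 0 := by
  constructor
  · obtain ⟨p, rfl⟩ := proj_surjective q
    rw [bump_proj, bumpLift]
    intro h
    have h1 := Real.cos_le_one (2 * Real.pi * p.1)
    have h2 := Real.cos_le_one (2 * Real.pi * p.2)
    exact Prod.ext (coe_eq_zero_of_cos (by linarith)) (coe_eq_zero_of_cos (by linarith))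
  · rintro rfl
    rw [show (0 : Torus) = proj (0, 0) from rfl, bump_proj]
    simp [bumpLift]

theorem contDiff_bumpLift : ContDiff ℝ ∞ bumpLift := by
  unfold bumpLift
  fun_prop

/-- The speed of the field `v_ρ`: it vanishes at two points of the leaf of the origin, the origin
and its image under the flow for the time `1/2`, and at the point `(ρ, 0)`. -/
noncomputable def speed (φ : ℝ) (ρ : UnitAddCircle) (q : Torus) : ℝ :=
  bump q * bump (q - flow φ (1 / 2)) * bump (q - (ρ, 0))

theorem speed_nonneg (φ : ℝ) (ρ : UnitAddCircle) (q : Torus) : 0 ≤ speed φ ρ q :=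
  mul_nonneg (mul_nonneg (bump_nonneg _) (bump_nonneg _)) (bump_nonneg _)

theorem speed_eq_zero_iff {φ : ℝ} {ρ : UnitAddCircle} {q : Torus} :
    speed φ ρ q = 0 ↔ q = 0 ∨ q = flow φ (1 / 2) ∨ q = (ρ, 0) := by
  simp only [speed, mul_eq_zero, bump_eq_zero_iff, sub_eq_zero, or_assoc]

theorem contDiff_speed (φ : ℝ) :
    ContDiff ℝ ∞ fun x : ℝ × (ℝ × ℝ) => speed φ (x.1 : UnitAddCircle) (proj x.2) := by
  have e : (fun x : ℝ × (ℝ × ℝ) => speed φ (x.1 : UnitAddCircle) (proj x.2)) = fun x =>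
      bumpLift x.2 * bumpLift (x.2 - (1 / 2 * φ, 1 / 2)) * bumpLift (x.2 - (x.1, 0)) := rfl
  rw [e]
  have := contDiff_bumpLift
  fun_prop

theorem contDiff_speed_proj (φ : ℝ) (ρ : UnitAddCircle) :
    ContDiff ℝ 2 fun p => speed φ ρ (proj p) := by
  obtain ⟨r, rfl⟩ := QuotientAddGroup.mk_surjective ρ
  exact contDiff_infty.1 ((contDiff_speed φ).comp (contDiff_prodMk_right r)) 2

/-- The family `v_ρ`, `ρ ∈ ℝ/ℤ`, of fields along the linear flow of slope `φ`. -/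
noncomputable def family (φ : ℝ) (ρ : UnitAddCircle) : VectorField :=
  alongField φ (speed φ ρ) (contDiff_speed_proj φ ρ)

theorem contDiff_family (φ : ℝ) : IsSmoothFamily (family φ) :=
  ((contDiff_speed φ).mul contDiff_const).prodMk (contDiff_speed φ)

/-- A smooth family is continuous for the `C²` topology. -/
theorem IsSmoothFamily.continuous {v : UnitAddCircle → VectorField} (hv : IsSmoothFamily v) :
    Continuous v := by
  refine continuous_induced_rng.2 ?_
  refine (QuotientAddGroup.isOpenQuotientMap_mk
    (N := AddSubgroup.zmultiples (1 : ℝ))).isQuotientMap.continuous_iff.2 ?_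
  have h0 : ContDiff ℝ 2 fun x : ℝ × (ℝ × ℝ) => (v (x.1 : UnitAddCircle)).lift x.2 :=
    contDiff_infty.1 hv 2
  have h1 : ContDiff ℝ 1 fun x : ℝ × (ℝ × ℝ) => fderiv ℝ (v (x.1 : UnitAddCircle)).lift x.2 :=
    ContDiff.fderiv (f := fun (x : ℝ × (ℝ × ℝ)) p => (v (x.1 : UnitAddCircle)).lift p)
      (g := Prod.snd)
      (h0.comp (g := fun x : ℝ × (ℝ × ℝ) => (v (x.1 : UnitAddCircle)).lift x.2)
        (f := fun y : (ℝ × (ℝ × ℝ)) × (ℝ × ℝ) => (y.1.1, y.2)) (by fun_prop))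
      contDiff_snd one_add_one_eq_two.le
  have h2 : ContDiff ℝ 0 fun x : ℝ × (ℝ × ℝ) =>
      fderiv ℝ (fderiv ℝ (v (x.1 : UnitAddCircle)).lift) x.2 :=
    ContDiff.fderiv (f := fun (x : ℝ × (ℝ × ℝ)) p => fderiv ℝ (v (x.1 : UnitAddCircle)).lift p)
      (g := Prod.snd)
      (h1.comp (g := fun x : ℝ × (ℝ × ℝ) => fderiv ℝ (v (x.1 : UnitAddCircle)).lift x.2)
        (f := fun y : (ℝ × (ℝ × ℝ)) × (ℝ × ℝ) => (y.1.1, y.2)) (by fun_prop))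
      contDiff_snd (by norm_num)
  exact (ContinuousMap.continuous_of_continuous_uncurry _ h0.continuous).prodMk
    ((ContinuousMap.continuous_of_continuous_uncurry _ h1.continuous).prodMk
      (ContinuousMap.continuous_of_continuous_uncurry _ h2.continuous))

/-! ### The equivalence relation of the family -/

theorem mem_range_flow_iff {φ : ℝ} {x : UnitAddCircle} :
    ((x, 0) : Torus) ∈ (flow φ).range ↔ ∃ n : ℤ, x = n • (φ : UnitAddCircle) := by
  constructor
  · rintro ⟨s, hs⟩
    obtain ⟨n, hn⟩ := (AddCircle.coe_eq_zero_iff (1 : ℝ)).1 (congrArg Prod.snd hs)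
    rw [zsmul_one] at hn
    subst hn
    refine ⟨n, (congrArg Prod.fst hs).symm.trans ?_⟩
    simp [flow]
  · rintro ⟨n, rfl⟩
    refine ⟨n, Prod.ext (by simp [flow]) ?_⟩
    exact (AddCircle.coe_eq_zero_iff 1).2 ⟨n, by simp⟩

theorem flow_half_ne_zero (φ : ℝ) : flow φ (1 / 2) ≠ 0 := by
  intro h
  obtain ⟨n, hn⟩ := (AddCircle.coe_eq_zero_iff (1 : ℝ)).1 (congrArg Prod.snd h)
  rw [zsmul_one] at hn
  have h2 : (2 * n : ℤ) = 1 := by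
    have : (2 * n : ℝ) = 1 := by linarith
    exact_mod_cast this
  omega

/-- Only countably many leaves contain a zero of the speed. -/
theorem exists_leaf_without_zero (φ : ℝ) (ρ : UnitAddCircle) :
    ∃ q : Torus, ∀ s, speed φ ρ (q + flow φ s) ≠ 0 := by
  obtain ⟨r, rfl⟩ := QuotientAddGroup.mk_surjective ρ
  have hc : (range (fun x : ℤ × ℤ => x.1 * φ + x.2) ∪
      range (fun x : ℤ × ℤ => r + (x.1 * φ + x.2))).Countable :=
    (countable_range _).union (countable_range _)
  obtain ⟨c, hcc⟩ := (hc.dense_compl ℝ).nonempty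
  have key : ∀ x : ℝ, proj (x, 0) ∈ (flow φ).range → ∃ m n : ℤ, x = m * φ + n := by
    intro x hx
    obtain ⟨m, hm⟩ := mem_range_flow_iff.1 hx
    have h : ((x - m * φ : ℝ) : UnitAddCircle) = 0 := by
      simp [hm]
    obtain ⟨n, hn⟩ := (AddCircle.coe_eq_zero_iff (1 : ℝ)).1 h
    rw [zsmul_one] at hn
    exact ⟨m, n, by linarith⟩
  have h1 : proj (c, 0) ∉ (flow φ).range := by
    intro h
    obtain ⟨m, n, h⟩ := key c h
    exact hcc (Or.inl ⟨(m, n), h.symm⟩)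
  have h2 : proj (c - r, 0) ∉ (flow φ).range := by
    intro h
    obtain ⟨m, n, h⟩ := key (c - r) h
    exact hcc (Or.inr ⟨(m, n), by simp only [← h]; ring⟩)
  refine ⟨proj (c, 0), fun s hs => ?_⟩
  rcases speed_eq_zero_iff.1 hs with h | h | h
  · exact h1 ⟨-s, by rw [map_neg]; exact (eq_neg_of_add_eq_zero_left h).symm⟩
  · exact h1 ⟨1 / 2 - s, by rw [map_sub, ← h, add_sub_cancel_right]⟩
  · refine h2 ⟨-s, ?_⟩
    rw [map_neg, neg_eq_iff_add_eq_zero]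
    have e : proj (c - r, 0) = proj (c, 0) - ((r : UnitAddCircle), 0) :=
      Prod.ext (by simp [proj]) (by simp [proj])
    rw [e, add_sub_assoc', sub_eq_zero, add_comm]
    exact h

/-- When the parameters differ by a multiple of the rotation, the moving zeros lie on a common leaf,
and one slides to the other without meeting the two fixed zeros. -/
theorem orbitallyEquivalent_family {φ : ℝ} {ρ₁ ρ₂ : UnitAddCircle}
    (h₁ : ∀ n : ℤ, ρ₁ ≠ n • (φ : UnitAddCircle)) {n : ℤ} (h : ρ₁ - ρ₂ = n • (φ : UnitAddCircle)) :
    (family φ ρ₁).OrbitallyEquivalent (family φ ρ₂) := by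
  have hρ : ((ρ₁, 0) : Torus) ∉ (flow φ).range := fun h => by
    obtain ⟨n, hn⟩ := mem_range_flow_iff.1 h
    exact h₁ n hn
  have hoff : ∀ z ∈ ({0, flow φ (1 / 2)} : Set Torus), ∀ s, z ≠ (ρ₁, 0) + flow φ s := by
    rintro z (rfl | rfl) s hz
    · exact hρ ⟨-s, by rw [map_neg]; exact neg_eq_of_add_eq_zero_left hz.symm⟩
    · exact hρ ⟨1 / 2 - s, by rw [map_sub, hz, add_sub_cancel_right]⟩
  obtain ⟨u, hu, hua, huZ, κ, hκ, hlip⟩ :=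
    exists_slide_time φ (toFinite _).isCompact hoff (-(n : ℝ))
  obtain ⟨H, hH⟩ := exists_homeomorph_slide hu hκ hlip
  have e0 : H 0 = 0 := by
    rw [hH, huZ 0 (by simp), map_zero, add_zero]
  have e1 : H (flow φ (1 / 2)) = flow φ (1 / 2) := by
    rw [hH, huZ _ (by simp), map_zero, add_zero]
  have e2 : H (ρ₁, 0) = (ρ₂, 0) := by
    have hn : ((n : ℝ) : UnitAddCircle) = 0 := (AddCircle.coe_eq_zero_iff 1).2 ⟨n, by simp⟩
    rw [hH, hua, eq_add_of_sub_eq h, map_neg]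
    exact Prod.ext (by simp [flow]) (by simp [flow, hn])
  refine orbitallyEquivalent_of_slide _ _ (speed_nonneg _ _) (speed_nonneg _ _) hu hκ hlip
    fun q => ?_
  have h0 : H q = 0 ↔ q = 0 := by rw [← H.injective.eq_iff (a := q), e0]
  have h1 : H q = flow φ (1 / 2) ↔ q = flow φ (1 / 2) := by
    rw [← H.injective.eq_iff (a := q), e1]
  have h2 : H q = (ρ₂, 0) ↔ q = (ρ₁, 0) := by rw [← H.injective.eq_iff (a := q), e2]
  rw [← hH, speed_eq_zero_iff, speed_eq_zero_iff, h0, h1, h2]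

/-- An equivalence translates the leaves and takes the three zeros to the three zeros. Two of the
zeros lie on the leaf of the origin, so that one of them stays on it; hence the translation is
trivial, and the third zero stays on its leaf. -/
theorem exists_zsmul_of_orbitallyEquivalent_family {φ : ℝ} (hφ : Irrational φ)
    {ρ₁ ρ₂ : UnitAddCircle} (h₁ : ∀ n : ℤ, ρ₁ ≠ n • (φ : UnitAddCircle))
    (h : (family φ ρ₁).OrbitallyEquivalent (family φ ρ₂)) :
    ∃ n : ℤ, ρ₁ - ρ₂ = n • (φ : UnitAddCircle) := by
  obtain ⟨q₀, hq₀⟩ := exists_leaf_without_zero φ ρ₁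
  obtain ⟨H, b, hz, hH⟩ := exists_translation_of_orbitallyEquivalent hφ _ _ (speed_nonneg _ _)
    (speed_nonneg _ _) hq₀ h
  have hL : ∀ s, flow φ s ∈ (flow φ).range := fun s => ⟨s, rfl⟩
  have hz0 := speed_eq_zero_iff.1 (hz 0 (speed_eq_zero_iff.2 (Or.inl rfl)))
  have hz1 := speed_eq_zero_iff.1 (hz _ (speed_eq_zero_iff.2 (Or.inr (Or.inl rfl))))
  have hz2 := speed_eq_zero_iff.1 (hz _ (speed_eq_zero_iff.2 (Or.inr (Or.inr rfl))))
  have hmem : ∀ q q' : Torus, H q = q' → q ∈ (flow φ).range → q' ∈ (flow φ).range →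
      b ∈ (flow φ).range := by
    rintro q _ rfl hq hq'
    have e : b = H q - q - (H q - (q + b)) := by abel
    rw [e]
    exact sub_mem (sub_mem hq' hq) (hH q)
  have hb : b ∈ (flow φ).range := by
    rcases hz0 with h0 | h0 | h0
    · exact hmem _ _ h0 (zero_mem _) (zero_mem _)
    · exact hmem _ _ h0 (zero_mem _) (hL _)
    rcases hz1 with h1 | h1 | h1
    · exact hmem _ _ h1 (hL _) (zero_mem _)
    · exact hmem _ _ h1 (hL _) (hL _)
    · exact absurd (H.injective (h1.trans h0.symm)) (flow_half_ne_zero φ)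
  have hdiff : (ρ₁, 0) - H (ρ₁, 0) ∈ (flow φ).range := by
    have e : (ρ₁, 0) - H (ρ₁, 0) = -(H (ρ₁, 0) - ((ρ₁, 0) + b)) - b := by abel
    rw [e]
    exact sub_mem (neg_mem (hH _)) hb
  have hρ : ((ρ₁, 0) : Torus) ∉ (flow φ).range := fun h => by
    obtain ⟨n, hn⟩ := mem_range_flow_iff.1 h
    exact h₁ n hn
  rcases hz2 with h2 | h2 | h2
  · rw [h2, sub_zero] at hdiff
    exact absurd hdiff hρ
  · rw [h2] at hdiff
    exact absurd (by simpa using add_mem hdiff (hL (1 / 2))) hρ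
  · rw [h2, Prod.mk_sub_mk, sub_zero] at hdiff
    exact mem_range_flow_iff.1 hdiff

end TorusField

theorem mainTheorem2 (φ : ℝ) (hφ : Irrational φ) :
    ∃ v : UnitAddCircle → TorusField.VectorField,
      TorusField.IsSmoothFamily v ∧
      (∀ ρ₁ ρ₂ : UnitAddCircle,
        (∀ n : ℤ, ρ₁ ≠ n • (φ : UnitAddCircle)) → (∀ n : ℤ, ρ₂ ≠ n • (φ : UnitAddCircle)) →
        (TorusField.VectorField.OrbitallyEquivalent (v ρ₁) (v ρ₂) ↔
          ∃ n : ℤ, ρ₁ - ρ₂ = n • (φ : UnitAddCircle))) ∧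
      TorusField.IsBorelReduction (TorusField.rotationRelOff φ)
        TorusField.VectorField.orbitalEquivalence (fun ρ : TorusField.OffOrbit φ => v ρ.val) := by
  have hequiv : ∀ ρ₁ ρ₂ : UnitAddCircle, (∀ n : ℤ, ρ₁ ≠ n • (φ : UnitAddCircle)) →
      (TorusField.VectorField.OrbitallyEquivalent (TorusField.family φ ρ₁)
        (TorusField.family φ ρ₂) ↔ ∃ n : ℤ, ρ₁ - ρ₂ = n • (φ : UnitAddCircle)) :=
    fun ρ₁ ρ₂ h₁ => ⟨TorusField.exists_zsmul_of_orbitallyEquivalent_family hφ h₁,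
      fun ⟨_, hn⟩ => TorusField.orbitallyEquivalent_family h₁ hn⟩
  have hcont : Continuous fun ρ : TorusField.OffOrbit φ => TorusField.family φ ρ.val :=
    (TorusField.contDiff_family φ).continuous.comp continuous_subtype_val
  refine ⟨TorusField.family φ, TorusField.contDiff_family φ, fun ρ₁ ρ₂ h₁ _ => hequiv ρ₁ ρ₂ h₁,
    fun A hA => MeasurableSpace.measurableSet_generateFrom (hA.preimage hcont), fun x y => ?_⟩
  refine Iff.trans ?_ (hequiv x.1 y.1 x.2).symm
  exact exists_congr fun n => sub_eq_iff_eq_add'.symm
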